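/- For a compact Hausdorff space $X$, let $C(X)$ be the algebra of continuous complex-valued functions on $X$ with the uniform norm. A uniform algebra on $X$ is a uniformly closed complex subalgebra $A$ of $C(X)$ that contains the constant functions and separates the points of $X$. It is $2$-local on $X$ if every $f\in C(X)$ for which there are $g_1,g_2\in A$ such that each point of $X$ has a neighbourhood on which $f$ agrees with $g_1$ or a neighbourhood on which $f$ agrees with $g_2$ belongs to $A$. A point $x\in X$ is a peak point for $A$ if there is $f\in A$ with $f(x)=1$ and $|f(t)|<1$ for all $t\in X\setminus\{x\}$. $A$ is strongly regular at $x$ if $J_x=\{f\in A: f^{-1}(\{0\})\text{ is a neighbourhood of }x\}$ is uniformly dense in $M_x=\{f\in A: f(x)=0\}$. **Proposition.** Let $X$ be the interval $[0,1]$ or the unit circle $\mathbb{T}$, and let $A$ be a uniform algebra on $X$. Suppose that $A$ is $2$-local on $X$ and that $X$ has a dense subset consisting of peak points for $A$ at which $A$ is strongly regular. Then $A=C(X)$. -/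

import Mathlib

open Topology

/-- A uniform algebra on a compact Hausdorff space `X`: a complex subalgebra of `C(X)` (it contains
the constants, being a unital subalgebra) that separates the points of `X` and is complete in
the uniform norm, i.e. closed in the Banach space `C(X)`. -/
structure IsUniformAlgebra {X : Type*} [TopologicalSpace X] [CompactSpace X] [T2Space X]
    (A : Subalgebra ℂ C(X, ℂ)) : Prop where
  separatesPoints : A.SeparatesPoints
  isClosed : IsClosed (A : Set C(X, ℂ))

/-- `M_x`: the functions in `A` that vanish at `x`. -/
def idealM {X : Type*} [TopologicalSpace X] (A : Subalgebra ℂ C(X, ℂ)) (x : X) :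
    Set C(X, ℂ) :=
  {f | f ∈ A ∧ f x = 0}

/-- `J_x`: the functions in `A` whose zero set is a neighbourhood of `x`. -/
def idealJ {X : Type*} [TopologicalSpace X] (A : Subalgebra ℂ C(X, ℂ)) (x : X) :
    Set C(X, ℂ) :=
  {f | f ∈ A ∧ f ⁻¹' {0} ∈ 𝓝 x}

/-- `A` is strongly regular at `x`: `J_x` (a subset of `M_x`) is dense in `M_x` for the
uniform norm. -/
def StronglyRegularAt {X : Type*} [TopologicalSpace X] [CompactSpace X]
    (A : Subalgebra ℂ C(X, ℂ)) (x : X) : Prop :=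
  idealM A x ⊆ closure (idealJ A x)

/-- `A` is 2-local on `X`: a continuous function `f` for which there are `g₁, g₂ ∈ A` such that
every point of `X` has a neighbourhood on which `f` agrees with `g₁`, or one on which `f` agrees
with `g₂`, belongs to `A`. -/
def IsTwoLocal {X : Type*} [TopologicalSpace X] (A : Subalgebra ℂ C(X, ℂ)) : Prop :=
  ∀ f : C(X, ℂ),
    (∃ g₁ ∈ A, ∃ g₂ ∈ A, ∀ x : X, ∃ U ∈ 𝓝 x, Set.EqOn f g₁ U ∨ Set.EqOn f g₂ U) → f ∈ A

/-- A closed set `E` is a peak set for `A` if some `f ∈ A` is constantly `1` on `E` and satisfies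
`|f| < 1` off `E`. -/
def IsPeakSet {X : Type*} [TopologicalSpace X] (A : Subalgebra ℂ C(X, ℂ)) (E : Set X) : Prop :=
  IsClosed E ∧ ∃ f ∈ A, (∀ t ∈ E, f t = 1) ∧ ∀ t ∉ E, ‖f t‖ < 1

/-- `x` is a peak point for `A` if `{x}` is a peak set for `A`. -/
def IsPeakPoint {X : Type*} [TopologicalSpace X] (A : Subalgebra ℂ C(X, ℂ)) (x : X) : Prop :=
  IsPeakSet A {x}

/-! ## Two-local uniform algebras on the interval and the circle

Fix a uniformly closed 2-local algebra `A` on a compact Hausdorff space, a finite set `F` of peak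
points at which `A` is strongly regular, and a set `U` with frontier in `F`. If `f ∈ A` vanishes on
`F`, then `f` cut off to `U` (that is, `1_U f`) again lies in `A`: for `f` vanishing near `F`
this is 2-locality, since `1_U f` is locally either `f` or `0`; the general case follows because
`f` is the uniform limit of such functions (`exists_mul_near`, where the peak functions and strong
regularity enter).

So functions of `A` that vanish on `F` can be glued along `U`. Given `f ∈ C(X)` and `ε > 0`, let a
finite cover of `X` by sets with frontier in `F` be so fine that `f` is `ε`-constant on each member.
Powers of peak functions produce `w ∈ A` that vanishes on `F`, is bounded by `3`, and is nearly `1`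
away from `F`. Gluing constant multiples of `w` gives an element of `A` close to `f * w`
(`exists_near_mul`). Adding `f₀ * (1 - w)`, where `f₀ ∈ A` interpolates `f` on `F`, gives an
element of `A` close to `f`. Hence `A = C(X)` as soon as every point has arbitrarily small
neighbourhoods whose frontier lies in a finite set of such points (`eq_top_of_base`). On the
interval and on the circle, open arcs with endpoints in the given dense set are such neighbourhoods
(at an endpoint of the interval, half-open ones).
-/

section

variable {X : Type*} [TopologicalSpace X] {A : Subalgebra ℂ C(X, ℂ)}

/-! ### Cutting off along a frontier -/

/-- The function equal to `f` on `U` and to `0` off `U`; it is continuous because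
`f` vanishes on the frontier of `U`. -/
noncomputable def cutoff (U : Set X) (f : C(X, ℂ)) (h : ∀ t ∈ frontier U, f t = 0) : C(X, ℂ) where
  toFun := U.indicator f
  continuous_toFun := continuous_indicator h f.continuous.continuousOn

lemma cutoff_apply_of_mem {U : Set X} {f : C(X, ℂ)} (h : ∀ t ∈ frontier U, f t = 0) {t : X}
    (ht : t ∈ U) : cutoff U f h t = f t := Set.indicator_of_mem ht _

lemma cutoff_apply_of_notMem {U : Set X} {f : C(X, ℂ)} (h : ∀ t ∈ frontier U, f t = 0) {t : X}
    (ht : t ∉ U) : cutoff U f h t = 0 := Set.indicator_of_notMem ht _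

/-- If `f` vanishes near the frontier of `U`, then the cutoff of `f` to `U` agrees locally with
`f` or with `0`. -/
lemma cutoff_mem_of_vanish_near (h2 : IsTwoLocal A) {U : Set X} {f : C(X, ℂ)} (hfA : f ∈ A)
    (h : ∀ t ∈ frontier U, f t = 0) (hnear : ∀ t ∈ frontier U, f ⁻¹' {0} ∈ 𝓝 t) :
    cutoff U f h ∈ A := by
  refine h2 _ ⟨f, hfA, 0, A.zero_mem, fun t => ?_⟩
  by_cases htF : t ∈ frontier U
  · refine ⟨_, hnear t htF, Or.inr fun s hs => ?_⟩
    by_cases hsU : s ∈ U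
    · rw [cutoff_apply_of_mem h hsU]; simpa using hs
    · rw [cutoff_apply_of_notMem h hsU]; rfl
  · rcases not_and_or.1 htF with ht | ht
    · refine ⟨(closure U)ᶜ, isClosed_closure.isOpen_compl.mem_nhds ht, Or.inr fun s hs => ?_⟩
      rw [cutoff_apply_of_notMem h fun hsU => hs (subset_closure hsU)]; rfl
    · exact ⟨interior U, isOpen_interior.mem_nhds (not_not.1 ht),
        Or.inl fun s hs => cutoff_apply_of_mem h (interior_subset hs)⟩

/-! ### Peak functions and strong regularity -/

variable [CompactSpace X]

/-- A high power of a peak function at `x` is small off any given neighbourhood of `x`. -/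
lemma IsPeakPoint.exists_small_off {x : X} (hx : IsPeakPoint A x) {N : Set X} (hN : IsOpen N)
    (hxN : x ∈ N) {δ : ℝ} (hδ : 0 < δ) :
    ∃ u ∈ A, u x = 1 ∧ (∀ t, ‖u t‖ ≤ 1) ∧ ∀ t ∉ N, ‖u t‖ ≤ δ := by
  obtain ⟨-, p, hpA, hp1, hp⟩ := hx
  have hpx : p x = 1 := hp1 x rfl
  have hle : ∀ t, ‖p t‖ ≤ 1 := fun t => by
    by_cases h : t = x
    · simp [h, hpx]
    · exact (hp t h).le
  rcases (Nᶜ).eq_empty_or_nonempty with he | hne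
  · refine ⟨p, hpA, hpx, hle, fun t ht => ?_⟩
    have : t ∈ Nᶜ := ht
    simp [he] at this
  · obtain ⟨t₀, ht₀, hmax⟩ := hN.isClosed_compl.isCompact.exists_isMaxOn hne
      (p.continuous.norm.continuousOn)
    have hlt : ‖p t₀‖ < 1 := hp t₀ fun h => ht₀ (h ▸ hxN)
    obtain ⟨n, hn⟩ := exists_pow_lt_of_lt_one hδ hlt
    refine ⟨p ^ n, A.pow_mem hpA n, by simp [hpx], fun t => ?_, fun t ht => ?_⟩
    · simpa using pow_le_one₀ (norm_nonneg _) (hle t)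
    · have h1 : ‖p t‖ ≤ ‖p t₀‖ := hmax ht
      simpa using (pow_le_pow_left₀ (norm_nonneg _) h1 n).trans hn.le

/-- Functions of `A` vanishing at `x` have approximate units in `J_x`. -/
lemma exists_mul_near_point {x : X} (hx : IsPeakPoint A x) (hs : StronglyRegularAt A x)
    {f : C(X, ℂ)} (hfx : f x = 0) {ε : ℝ} (hε : 0 < ε) :
    ∃ e ∈ idealJ A x, ‖e * f - f‖ ≤ ε := by
  have hC : 0 < ‖f‖ + 1 := by positivity
  have hη : 0 < ε / 2 / (‖f‖ + 1) := by positivity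
  obtain ⟨u, huA, hux, hu1, hu⟩ := hx.exists_small_off
    (N := {t | ‖f t‖ < ε / 2}) (isOpen_lt (by fun_prop) continuous_const)
    (by simpa [hfx] using hε) hη
  obtain ⟨e, heJ, he⟩ := Metric.mem_closure_iff.1
    (hs ⟨A.sub_mem A.one_mem huA, by simp [hux]⟩ : (1 - u) ∈ closure (idealJ A x)) _ hη
  refine ⟨e, heJ, ?_⟩
  have huf : ‖u * f‖ ≤ ε / 2 := by
    refine (ContinuousMap.norm_le _ (by positivity)).2 fun t => ?_
    rw [ContinuousMap.mul_apply, norm_mul]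
    by_cases ht : ‖f t‖ < ε / 2
    · calc ‖u t‖ * ‖f t‖ ≤ 1 * (ε / 2) := by gcongr; exact hu1 t
        _ = ε / 2 := one_mul _
    · calc ‖u t‖ * ‖f t‖ ≤ ε / 2 / (‖f‖ + 1) * (‖f‖ + 1) := by
            gcongr
            · exact hu t ht
            · exact (f.norm_coe_le_norm t).trans (by linarith)
        _ = ε / 2 := div_mul_cancel₀ _ hC.ne'
  have hef : ‖(e - (1 - u)) * f‖ ≤ ε / 2 := by
    calc ‖(e - (1 - u)) * f‖ ≤ ‖e - (1 - u)‖ * ‖f‖ := norm_mul_le _ _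
      _ ≤ ε / 2 / (‖f‖ + 1) * (‖f‖ + 1) := by
          gcongr
          · rw [← dist_eq_norm, dist_comm]; exact he.le
          · linarith
      _ = ε / 2 := div_mul_cancel₀ _ hC.ne'
  calc ‖e * f - f‖ = ‖(e - (1 - u)) * f - u * f‖ := by congr 1; ring
    _ ≤ _ := norm_sub_le _ _
    _ ≤ ε := by linarith

/-- A function vanishing on a finite set `F` of strongly regular peak points is
nearly unchanged by multiplication with some element of `A` that vanishes near `F`. -/
lemma exists_mul_near (F : Finset X)
    (hF : ∀ x ∈ F, IsPeakPoint A x ∧ StronglyRegularAt A x) {f : C(X, ℂ)}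
    (hf : ∀ x ∈ F, f x = 0) {ε : ℝ} (hε : 0 < ε) :
    ∃ e ∈ A, (∀ x ∈ F, e ⁻¹' {0} ∈ 𝓝 x) ∧ ‖e * f - f‖ ≤ ε := by
  classical
  induction F using Finset.induction_on generalizing ε with
  | empty => exact ⟨1, A.one_mem, by simp, by simpa using hε.le⟩
  | insert x F _ ih =>
    obtain ⟨e, heA, heF, he⟩ := ih (fun y hy => hF y (Finset.mem_insert_of_mem hy))
      (fun y hy => hf y (Finset.mem_insert_of_mem hy)) (half_pos hε)
    obtain ⟨hp, hs⟩ := hF x (Finset.mem_insert_self _ _)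
    obtain ⟨d, ⟨hdA, hdx⟩, hd⟩ := exists_mul_near_point hp hs (f := e * f)
      (by simp [hf x (Finset.mem_insert_self _ _)]) (half_pos hε)
    refine ⟨d * e, A.mul_mem hdA heA, fun y hy => ?_, ?_⟩
    · rcases Finset.mem_insert.1 hy with rfl | hy
      · filter_upwards [hdx] with t ht
        simp_all
      · filter_upwards [heF y hy] with t ht
        simp_all
    · calc ‖d * e * f - f‖ = ‖(d * (e * f) - e * f) + (e * f - f)‖ := by congr 1; ring
        _ ≤ _ := norm_add_le _ _
        _ ≤ ε := by linarith

/-- Functions of `A` that vanish on a finite set of strongly regular peak points can be cut off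
along any set whose frontier is contained in it. -/
lemma cutoff_mem (hA : IsClosed (A : Set C(X, ℂ))) (h2 : IsTwoLocal A) (F : Finset X)
    (hF : ∀ x ∈ F, IsPeakPoint A x ∧ StronglyRegularAt A x) {U : Set X} (hU : frontier U ⊆ F)
    {f : C(X, ℂ)} (hfA : f ∈ A) (hf : ∀ x ∈ F, f x = 0) :
    cutoff U f (fun t ht => hf t (hU ht)) ∈ A := by
  refine hA.closure_subset (Metric.mem_closure_iff.2 fun ε hε => ?_)
  obtain ⟨e, heA, heF, he⟩ := exists_mul_near F hF hf (half_pos hε)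
  have h0 : ∀ t ∈ frontier U, (e * f) t = 0 := fun t ht => by simp [hf t (hU ht)]
  refine ⟨cutoff U (e * f) h0,
    cutoff_mem_of_vanish_near h2 (A.mul_mem heA hfA) _ fun t ht => ?_, ?_⟩
  · filter_upwards [heF t (hU ht)] with s hs
    simp_all
  · refine lt_of_le_of_lt ?_ (half_lt_self hε)
    refine (ContinuousMap.dist_le (half_pos hε).le).2 fun t => ?_
    by_cases ht : t ∈ U
    · rw [cutoff_apply_of_mem _ ht, cutoff_apply_of_mem _ ht, dist_comm, dist_eq_norm]
      exact ((e * f - f).norm_coe_le_norm t).trans he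
    · rw [cutoff_apply_of_notMem _ ht, cutoff_apply_of_notMem _ ht, dist_self]
      exact (half_pos hε).le

/-- If `w ∈ A` vanishes on `F`, then `f * w` is close to an element of `A` on any finite
union of sets with frontier in `F` on each of which `f` is nearly constant. -/
lemma exists_near_mul (hA : IsClosed (A : Set C(X, ℂ))) (h2 : IsTwoLocal A) (F : Finset X)
    (hF : ∀ x ∈ F, IsPeakPoint A x ∧ StronglyRegularAt A x) {f w : C(X, ℂ)} (hwA : w ∈ A)
    (hw : ∀ x ∈ F, w x = 0) {ε : ℝ} {ι : Type*} (T : Finset ι) (U : ι → Set X) (c : ι → ℂ)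
    (hU : ∀ i ∈ T, frontier (U i) ⊆ F) (hc : ∀ i ∈ T, ∀ t ∈ U i, ‖c i - f t‖ ≤ ε) :
    ∃ g ∈ A, (∀ x ∈ F, g x = 0) ∧ ∀ i ∈ T, ∀ t ∈ U i, ‖g t - f t * w t‖ ≤ ε * ‖w t‖ := by
  classical
  induction T using Finset.induction_on with
  | empty => exact ⟨0, A.zero_mem, by simp, by simp⟩
  | insert k T _ ih =>
    obtain ⟨g, hgA, hgF, hg⟩ := ih (fun i hi => hU i (Finset.mem_insert_of_mem hi))
      (fun i hi => hc i (Finset.mem_insert_of_mem hi))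
    have hk := hU k (Finset.mem_insert_self _ _)
    have hF0 : ∀ x ∈ F, (c k • w - g) x = 0 := fun x hx => by simp [hw x hx, hgF x hx]
    -- The new function is `c k • w` on `U k`, and still `g` elsewhere.
    have hmem := cutoff_mem hA h2 F hF hk (A.sub_mem (A.smul_mem hwA (c k)) hgA) hF0
    refine ⟨_, A.add_mem hgA hmem, fun x hx => ?_, fun i hi t ht => ?_⟩
    · by_cases hxU : x ∈ U k
      · rw [ContinuousMap.add_apply, cutoff_apply_of_mem _ hxU, hgF x hx, hF0 x hx, add_zero]
      · rw [ContinuousMap.add_apply, cutoff_apply_of_notMem _ hxU, hgF x hx, add_zero]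
    · by_cases htU : t ∈ U k
      · rw [ContinuousMap.add_apply, cutoff_apply_of_mem _ htU]
        calc ‖g t + (c k • w - g) t - f t * w t‖ = ‖(c k - f t) * w t‖ := by
              congr 1
              simp only [ContinuousMap.sub_apply, ContinuousMap.smul_apply, smul_eq_mul]
              ring
          _ ≤ ε * ‖w t‖ := by
              rw [norm_mul]
              gcongr
              exact hc k (Finset.mem_insert_self _ _) t htU
      · rw [ContinuousMap.add_apply, cutoff_apply_of_notMem _ htU, add_zero]
        rcases Finset.mem_insert.1 hi with rfl | hi
        · exact absurd ht htU
        · exact hg i hi t ht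

/-! ### Functions vanishing on a finite set of peak points -/

variable [T2Space X]

/-- There is an element of `A` vanishing on a finite set `F` of peak points, uniformly close to `1`
off a given neighbourhood of `F`, and of norm barely more than `2`. It is a product of factors
`1 - u` with `u` a peak function; at most one factor at a time is far from `1`, which keeps the norm
bounded independently of `F`. -/
lemma exists_vanishing_near_one (F : Finset X) (hF : ∀ x ∈ F, IsPeakPoint A x) {N : Set X}
    (hN : IsOpen N) (hFN : ∀ x ∈ F, x ∈ N) {δ : ℝ} (hδ : 0 < δ) :
    ∃ w ∈ A, (∀ x ∈ F, w x = 0) ∧ (∀ t ∉ N, ‖1 - w t‖ ≤ δ) ∧ ∀ t, ‖w t‖ ≤ 2 + δ := by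
  classical
  induction F using Finset.induction_on generalizing N δ with
  | empty =>
    exact ⟨1, A.one_mem, by simp, by simpa using fun _ _ => hδ.le, fun t => by
      rw [ContinuousMap.one_apply, norm_one]; linarith⟩
  | insert x F hxF ih =>
    obtain ⟨V, W, hV, hW, hxV, hFW, hVW⟩ := SeparatedNhds.of_isCompact_isCompact
      (isCompact_singleton (x := x)) F.finite_toSet.isCompact (by simpa using hxF)
    obtain ⟨η, hη, hη1, hηδ⟩ : ∃ η : ℝ, 0 < η ∧ η ≤ 1 ∧ 4 * η ≤ δ :=
      ⟨min 1 (δ / 4), by positivity, min_le_left _ _,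
        by linarith [min_le_right 1 (δ / 4)]⟩
    obtain ⟨w, hwA, hwF, hw1, hw2⟩ := ih (fun y hy => hF y (Finset.mem_insert_of_mem hy))
      (hN.inter hW) (fun y hy => ⟨hFN y (Finset.mem_insert_of_mem hy), hFW hy⟩) hη
    obtain ⟨u, huA, hux, hu1, hu⟩ := (hF x (Finset.mem_insert_self _ _)).exists_small_off
      (hN.inter hV) ⟨hFN x (Finset.mem_insert_self _ _), hxV rfl⟩ hη
    refine ⟨w * (1 - u), A.mul_mem hwA (A.sub_mem A.one_mem huA), fun y hy => ?_,
      fun t ht => ?_, fun t => ?_⟩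
    · rcases Finset.mem_insert.1 hy with rfl | hy
      · simp [hux]
      · simp [hwF y hy]
    · have h1 := hw1 t fun h => ht h.1
      have h2 := hu t fun h => ht h.1
      have h3 : ‖w t‖ ≤ 3 := (hw2 t).trans (by linarith)
      calc ‖1 - (w * (1 - u)) t‖ = ‖(1 - w t) + w t * u t‖ := by
            congr 1
            simp only [ContinuousMap.mul_apply, ContinuousMap.sub_apply, ContinuousMap.one_apply]
            ring
        _ ≤ ‖1 - w t‖ + ‖w t‖ * ‖u t‖ := (norm_add_le _ _).trans_eq (by rw [norm_mul])
        _ ≤ η + 3 * η := by gcongr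
        _ ≤ δ := by linarith
    · have hsub : ‖1 - u t‖ ≤ 1 + ‖u t‖ := (norm_sub_le _ _).trans_eq (by simp)
      have heq : ‖(w * (1 - u)) t‖ = ‖w t‖ * ‖1 - u t‖ := by simp
      rw [heq]
      by_cases ht : t ∈ V
      · have h1 := hw1 t fun h => Set.disjoint_left.1 hVW ht h.2
        have h2 : ‖w t‖ ≤ 1 + η := by
          have := norm_sub_norm_le (w t) 1
          rw [norm_sub_rev, norm_one] at this
          linarith
        calc ‖w t‖ * ‖1 - u t‖ ≤ (1 + η) * 2 := by
              gcongr
              linarith [hu1 t]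
          _ ≤ 2 + δ := by linarith
      · have h1 := hu t fun h => ht h.2
        calc ‖w t‖ * ‖1 - u t‖ ≤ (2 + η) * (1 + η) := by
              gcongr
              · exact hw2 t
              · linarith
          _ ≤ 2 + δ := by nlinarith

lemma exists_interpolation (F : Finset X) (hF : ∀ x ∈ F, IsPeakPoint A x) (f : X → ℂ) :
    ∃ g ∈ A, ∀ x ∈ F, g x = f x := by
  classical
  induction F using Finset.induction_on with
  | empty => exact ⟨0, A.zero_mem, by simp⟩
  | insert x F hxF ih =>
    have hF' : ∀ y ∈ F, IsPeakPoint A y := fun y hy => hF y (Finset.mem_insert_of_mem hy)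
    obtain ⟨g, hgA, hg⟩ := ih hF'
    obtain ⟨w, hwA, hwF, hw, -⟩ := exists_vanishing_near_one F hF' (N := {x}ᶜ)
      isOpen_compl_singleton (fun y hy h => hxF (h ▸ hy)) one_half_pos
    have hwx : w x ≠ 0 := fun h => by
      have := hw x (by simp)
      norm_num [h] at this
    refine ⟨g + ((f x - g x) / w x) • w, A.add_mem hgA (A.smul_mem hwA _), fun y hy => ?_⟩
    rcases Finset.mem_insert.1 hy with rfl | hy
    · simp [hwx]
    · simp [hwF y hy, hg y hy]

/-! ### The approximation theorem -/

/-- A closed 2-local algebra is all of `C(X)` if every point of `X` has arbitrarily small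
neighbourhoods whose frontiers are contained in finite sets of peak points at which the algebra is
strongly regular. -/
theorem eq_top_of_base (hA : IsClosed (A : Set C(X, ℂ))) (h2 : IsTwoLocal A)
    (hbase : ∀ x : X, ∀ N ∈ 𝓝 x, ∃ U ∈ 𝓝 x, U ⊆ N ∧ ∃ F : Finset X,
      (∀ y ∈ F, IsPeakPoint A y ∧ StronglyRegularAt A y) ∧ frontier U ⊆ F) :
    A = ⊤ := by
  classical
  refine eq_top_iff.2 fun f _ => hA.closure_subset (Metric.mem_closure_iff.2 fun ε' hε' => ?_)
  obtain ⟨ε, hε, hεε'⟩ : ∃ ε : ℝ, 0 < ε ∧ 7 * ε < ε' := ⟨ε' / 8, by positivity, by linarith⟩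
  choose U hU hUN G hG hUG using fun x => hbase x {t | ‖f x - f t‖ < ε}
    ((isOpen_lt (by fun_prop) continuous_const).mem_nhds (by simpa using hε))
  obtain ⟨T, hT⟩ := CompactSpace.elim_nhds_subcover U hU
  set F : Finset X := T.biUnion G
  have hF : ∀ y ∈ F, IsPeakPoint A y ∧ StronglyRegularAt A y := fun y hy => by
    obtain ⟨x, -, hx⟩ := Finset.mem_biUnion.1 hy
    exact hG x y hx
  obtain ⟨f₀, hf₀A, hf₀⟩ := exists_interpolation F (fun y hy => (hF y hy).1) f
  have hC : 0 < ‖f - f₀‖ + 1 := by positivity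
  obtain ⟨δ, hδ, hδ1, hδC⟩ : ∃ δ : ℝ, 0 < δ ∧ δ ≤ 1 ∧ δ * (‖f - f₀‖ + 1) ≤ ε :=
    ⟨min 1 (ε / (‖f - f₀‖ + 1)), by positivity, min_le_left _ _,
      (le_div_iff₀ hC).1 (min_le_right _ _)⟩
  obtain ⟨w, hwA, hwF, hw1, hw3⟩ := exists_vanishing_near_one F (fun y hy => (hF y hy).1)
    (N := {t | ‖f t - f₀ t‖ < ε}) (isOpen_lt (by fun_prop) continuous_const)
    (fun y hy => by simpa [hf₀ y hy] using hε) hδ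
  obtain ⟨g, hgA, -, hg⟩ := exists_near_mul hA h2 F hF (f := f) hwA hwF T U f
    (fun i hi => (hUG i).trans (by exact_mod_cast Finset.subset_biUnion_of_mem G hi))
    (fun i _ t ht => (hUN i ht).le)
  refine ⟨g + f₀ * (1 - w), A.add_mem hgA (A.mul_mem hf₀A (A.sub_mem A.one_mem hwA)),
    lt_of_le_of_lt ?_ hεε'⟩
  refine (ContinuousMap.dist_le (by positivity)).2 fun t => ?_
  obtain ⟨i, hi, hti⟩ : ∃ i ∈ T, t ∈ U i := by
    have : t ∈ ⋃ x ∈ T, U x := hT ▸ Set.mem_univ t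
    simpa using this
  have hw3t : ‖w t‖ ≤ 3 := (hw3 t).trans (by linarith)
  have hgt : ‖g t - f t * w t‖ ≤ ε * 3 := (hg i hi t hti).trans (by gcongr)
  have hrest : ‖f t - f₀ t‖ * ‖1 - w t‖ ≤ ε * 4 := by
    by_cases ht : ‖f t - f₀ t‖ < ε
    · gcongr
      refine (norm_sub_le _ _).trans ?_
      rw [norm_one]
      linarith
    · calc ‖f t - f₀ t‖ * ‖1 - w t‖ ≤ (‖f - f₀‖ + 1) * δ := by
            gcongr
            · exact ((f - f₀).norm_coe_le_norm t).trans (by linarith)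
            · exact hw1 t ht
        _ ≤ ε * 4 := by linarith
  calc dist (f t) ((g + f₀ * (1 - w)) t)
      = ‖(f t - f₀ t) * (1 - w t) - (g t - f t * w t)‖ := by
        rw [dist_eq_norm]
        congr 1
        simp only [ContinuousMap.add_apply, ContinuousMap.mul_apply, ContinuousMap.sub_apply,
          ContinuousMap.one_apply]
        ring
    _ ≤ ‖f t - f₀ t‖ * ‖1 - w t‖ + ‖g t - f t * w t‖ :=
        (norm_sub_le _ _).trans_eq (by rw [norm_mul])
    _ ≤ 7 * ε := by linarith

end

/-! ### Neighbourhood bases with finite frontiers -/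

lemma unitInterval.exists_nhds_finite_frontier {S : Set unitInterval} (hS : Dense S)
    (x : unitInterval) {N : Set unitInterval} (hN : N ∈ 𝓝 x) :
    ∃ U ∈ 𝓝 x, U ⊆ N ∧ ∃ F : Finset unitInterval, (∀ y ∈ F, y ∈ S) ∧ frontier U ⊆ F := by
  classical
  -- One half-line on each side of `x`; on the side of an endpoint the whole interval serves.
  obtain ⟨L, hLo, hxL, hLN, F, hFS, hLF⟩ : ∃ L : Set unitInterval, IsOpen L ∧ x ∈ L ∧
      (∀ t ∈ L, t ≤ x → t ∈ N) ∧ ∃ F : Finset unitInterval, (∀ y ∈ F, y ∈ S) ∧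
      frontier L ⊆ F := by
    by_cases hx : ∃ l, l < x
    · obtain ⟨l, hl, hlN⟩ := exists_Ioc_subset_of_mem_nhds hN hx
      obtain ⟨a, haS, hla, hax⟩ := hS.exists_between hl
      refine ⟨Set.Ioi a, isOpen_Ioi, hax, fun t hat htx => hlN ⟨hla.trans hat, htx⟩, {a},
        by simpa using haS, ?_⟩
      rw [frontier_Ioi' ⟨x, hax⟩]
      simp
    · refine ⟨Set.univ, isOpen_univ, trivial, fun t _ htx => ?_, ∅, by simp, by simp⟩
      rw [le_antisymm htx (not_lt.1 fun h => hx ⟨t, h⟩)]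
      exact mem_of_mem_nhds hN
  obtain ⟨R, hRo, hxR, hRN, G, hGS, hRG⟩ : ∃ R : Set unitInterval, IsOpen R ∧ x ∈ R ∧
      (∀ t ∈ R, x ≤ t → t ∈ N) ∧ ∃ G : Finset unitInterval, (∀ y ∈ G, y ∈ S) ∧
      frontier R ⊆ G := by
    by_cases hx : ∃ r, x < r
    · obtain ⟨r, hr, hrN⟩ := exists_Ico_subset_of_mem_nhds hN hx
      obtain ⟨b, hbS, hxb, hbr⟩ := hS.exists_between hr
      refine ⟨Set.Iio b, isOpen_Iio, hxb, fun t htb hxt => hrN ⟨hxt, htb.trans hbr⟩, {b},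
        by simpa using hbS, ?_⟩
      rw [frontier_Iio' ⟨x, hxb⟩]
      simp
    · refine ⟨Set.univ, isOpen_univ, trivial, fun t _ htx => ?_, ∅, by simp, by simp⟩
      rw [le_antisymm (not_lt.1 fun h => hx ⟨t, h⟩) htx]
      exact mem_of_mem_nhds hN
  refine ⟨L ∩ R, (hLo.inter hRo).mem_nhds ⟨hxL, hxR⟩, fun t ht => ?_, F ∪ G, fun y hy => ?_, ?_⟩
  · exact (le_total t x).elim (hLN t ht.1) (hRN t ht.2)
  · exact (Finset.mem_union.1 hy).elim (hFS y) (hGS y)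
  · intro y hy
    rw [Finset.coe_union]
    exact (frontier_inter_subset L R hy).imp (fun h => hLF h.1) (fun h => hRG h.2)

lemma Circle.exists_nhds_finite_frontier {S : Set Circle} (hS : Dense S) (x : Circle)
    {N : Set Circle} (hN : N ∈ 𝓝 x) :
    ∃ U ∈ 𝓝 x, U ⊆ N ∧ ∃ F : Finset Circle, (∀ y ∈ F, y ∈ S) ∧ frontier U ⊆ F := by
  classical
  have hopen : IsOpenMap Circle.exp := isLocalHomeomorph_circleExp.isOpenMap
  obtain ⟨θ, rfl⟩ : ∃ θ, Circle.exp θ = x := ⟨_, Circle.exp_arg x⟩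
  obtain ⟨l, r, ⟨hl, hr⟩, hlr⟩ := mem_nhds_iff_exists_Ioo_subset.1
    (Circle.exp.continuous.continuousAt.preimage_mem_nhds hN)
  have hS' : Dense (Circle.exp ⁻¹' S) := hS.preimage hopen
  obtain ⟨a, haS, hla, ha⟩ := hS'.exists_between hl
  obtain ⟨b, hbS, hb, hbr⟩ := hS'.exists_between hr
  have hUo : IsOpen (Circle.exp '' Set.Ioo a b) := hopen _ isOpen_Ioo
  refine ⟨Circle.exp '' Set.Ioo a b, hUo.mem_nhds ⟨θ, ⟨ha, hb⟩, rfl⟩, ?_,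
    {Circle.exp a, Circle.exp b}, ?_, ?_⟩
  · rintro _ ⟨s, hs, rfl⟩
    exact hlr ⟨hla.trans hs.1, hs.2.trans hbr⟩
  · simpa using ⟨haS, hbS⟩
  · intro y hy
    have hcl : y ∈ Circle.exp '' Set.Icc a b :=
      closure_minimal (Set.image_mono Set.Ioo_subset_Icc_self)
        (isCompact_Icc.image Circle.exp.continuous).isClosed hy.1
    obtain ⟨s, hs, rfl⟩ := hcl
    have hs' : s ∉ Set.Ioo a b := fun h => hy.2 (hUo.interior_eq.symm ▸ ⟨s, h, rfl⟩)
    rcases eq_or_lt_of_le hs.1 with rfl | h1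
    · simp
    · rcases eq_or_lt_of_le hs.2 with rfl | h2
      · simp
      · exact absurd ⟨h1, h2⟩ hs'

theorem proposition10 :
    (∀ A : Subalgebra ℂ C(unitInterval, ℂ), IsUniformAlgebra A → IsTwoLocal A →
      (∃ S : Set unitInterval, Dense S ∧ ∀ x ∈ S, IsPeakPoint A x ∧ StronglyRegularAt A x) →
      A = ⊤) ∧
    (∀ A : Subalgebra ℂ C(Circle, ℂ), IsUniformAlgebra A → IsTwoLocal A →
      (∃ S : Set Circle, Dense S ∧ ∀ x ∈ S, IsPeakPoint A x ∧ StronglyRegularAt A x) →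
      A = ⊤) := by
  constructor
  · rintro A hA h2 ⟨S, hS, hSA⟩
    refine eq_top_of_base hA.isClosed h2 fun x N hN => ?_
    obtain ⟨U, hU, hUN, F, hF, hUF⟩ := unitInterval.exists_nhds_finite_frontier hS x hN
    exact ⟨U, hU, hUN, F, fun y hy => hSA y (hF y hy), hUF⟩
  · rintro A hA h2 ⟨S, hS, hSA⟩
    refine eq_top_of_base hA.isClosed h2 fun x N hN => ?_
    obtain ⟨U, hU, hUN, F, hF, hUF⟩ := Circle.exists_nhds_finite_frontier hS x hN
    exact ⟨U, hU, hUN, F, fun y hy => hSA y (hF y hy), hUF⟩
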